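/- Let $\lambda,\mu,\alpha,\beta>0$. Model 1 (unreliable $M/M/1$ queue) is the continuous-time Markov chain $(X(t),\sigma(t))$ on $\mathbb{N}\times\{Up,Down\}$, $\mathbb{N}=\{0,1,2,\dots\}$, with transition intensities: $(x,\sigma)\to(x+1,\sigma)$ at rate $\lambda$; $(x,Up)\to(x-1,Up)$ at rate $\mu$ if $x\ge 1$; $(x,Up)\to(x,Down)$ at rate $\alpha$; $(x,Down)\to(x,Up)$ at rate $\beta$. Model 2 with parameter $p\in(0,1]$ (a reliable server 2 followed by the unreliable server 1, with feedback from server 1 to server 2) is the continuous-time Markov chain $(X(t),Y(t),\sigma(t))$ on $\mathbb{N}\times\mathbb{N}\times\{Up,Down\}$, where $X$ and $Y$ are the numbers of customers at servers 1 and 2 and $\sigma$ is the status of server 1, with transition intensities: $(x,y,\sigma)\to(x,y+1,\sigma)$ at rate $\lambda$; $(x,y,\sigma)\to(x+1,y-1,\sigma)$ at rate $\mu$ if $y\ge1$; $(x,y,Up)\to(x-1,y,Up)$ at rate $\mu p$ and $(x,y,Up)\to(x-1,y+1,Up)$ at rate $\mu(1-p)$ if $x\ge1$; $(x,y,Up)\to(x,y,Down)$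 at rate $\alpha$; $(x,y,Down)\to(x,y,Up)$ at rate $\beta$. A chain is called ergodic if it is irreducible and, from every initial state, its law at time $t$ converges as $t\to\infty$ to one and the same probability distribution; it is called stable if it has a unique stationary distribution. Then: (a) Model 1 is ergodic if and only if $\lambda<\frac{\beta}{\alpha+\beta}\mu$. (b) Model 2 with $p=1$ is ergodic if and only if $\lambda<\frac{\beta}{\alpha+\beta}\mu$. (c) For every $p\in(0,1)$, if $\lambda<\frac{\beta}{\alpha+\beta}\mu p$, then Model 2 with parameter $p$ is stable. -/

import Mathlib

open scoped NNReal ENNReal Topology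

noncomputable section

/-! ### Continuous-time Markov chains with bounded intensities on a countable state space

A chain is given by its transition intensities `q x y ≥ 0` for `x ≠ y`; the diagonal of `q` is
zero for the chains below. -/

/-- Total intensity of leaving the state `x`. -/
def exitRate {E : Type*} (q : E → E → ℝ≥0∞) (x : E) : ℝ≥0∞ :=
  ∑' y, q x y

/-- The supremum of the exit rates (finite for the chains below). -/
def maxRate {E : Type*} (q : E → E → ℝ≥0∞) : ℝ≥0∞ :=
  ⨆ x, exitRate q x

/-- One-step transition matrix `I + Q / C` of the uniformized chain, where `Q` is the generator
with off-diagonal entries `q x y` and `C = maxRate q`. -/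
def unifStep {E : Type*} [DecidableEq E] (q : E → E → ℝ≥0∞) (x y : E) : ℝ≥0∞ :=
  q x y / maxRate q + if y = x then 1 - exitRate q x / maxRate q else 0

/-- `n`-step transition matrix of the uniformized chain. -/
def unifSteps {E : Type*} [DecidableEq E] (q : E → E → ℝ≥0∞) : ℕ → E → E → ℝ≥0∞
  | 0, x, y => if y = x then 1 else 0
  | n + 1, x, y => ∑' z, unifSteps q n x z * unifStep q z y

/-- Transition probabilities `P_t(x, y) = P(Z(t) = y | Z(0) = x)` of the continuous-time Markov
chain `Z` with intensities `q`, that is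
`exp(tQ) = ∑ₙ exp(-Ct) (Ct)ⁿ / n! (I + Q / C)ⁿ` with `C = maxRate q`. -/
def transProb {E : Type*} [DecidableEq E] (q : E → E → ℝ≥0∞) (t : ℝ≥0) (x y : E) : ℝ≥0∞ :=
  ∑' n : ℕ,
    ENNReal.ofReal (Real.exp (-((maxRate q).toReal * t)) * ((maxRate q).toReal * t) ^ n /
      (n.factorial : ℝ)) * unifSteps q n x y

/-- Every state can be reached from every state. -/
def IsIrreducibleChain {E : Type*} (P : ℝ≥0 → E → E → ℝ≥0∞) : Prop :=
  ∀ x y, ∃ t, 0 < P t x y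

/-- `π` is a stationary distribution. -/
def IsStationaryDist {E : Type*} (P : ℝ≥0 → E → E → ℝ≥0∞) (π : PMF E) : Prop :=
  ∀ t y, ∑' x, π x * P t x y = π y

/-- Stability: there is a unique stationary distribution. -/
def IsStable {E : Type*} (P : ℝ≥0 → E → E → ℝ≥0∞) : Prop :=
  ∃! π : PMF E, IsStationaryDist P π

/-- Ergodicity: the chain is irreducible and, from every initial state, the law at time `t`
converges as `t → ∞` to one and the same probability distribution. -/
def IsErgodicChain {E : Type*} (P : ℝ≥0 → E → E → ℝ≥0∞) : Prop :=
  IsIrreducibleChain P ∧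
    ∃ π : PMF E, ∀ x y, Filter.Tendsto (fun t : ℝ≥0 => P t x y) Filter.atTop (𝓝 (π y))

/-! ### The two queueing systems -/

/-- Status of the unreliable server. -/
inductive Status
  | up
  | down
  deriving DecidableEq

/-- Transition intensities of the unreliable `M/M/1` queue. A state is (number of customers,
status); arrivals occur at rate `lam`, services at rate `mu` when the server is up and not empty,
breakdowns at rate `α`, repairs at rate `β`. -/
def model1Rate (lam mu α β : ℝ) : ℕ × Status → ℕ × Status → ℝ≥0∞
  | (x, .up), (x', .up) =>
      (if x' = x + 1 then ENNReal.ofReal lam else 0) +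
      (if x' + 1 = x then ENNReal.ofReal mu else 0)
  | (x, .down), (x', .down) => if x' = x + 1 then ENNReal.ofReal lam else 0
  | (x, .up), (x', .down) => if x' = x then ENNReal.ofReal α else 0
  | (x, .down), (x', .up) => if x' = x then ENNReal.ofReal β else 0

/-- Transition intensities of the two-server network. A state is (number `x` of customers at the
unreliable server 1, number `y` at the reliable server 2, status of server 1). Customers arrive at
server 2 at rate `lam`; a service at server 2 (rate `mu`) sends a customer to server 1, whatever
its status; a service at server 1 (rate `mu`, only when it is up) makes the customer leave with
probability `p` and return to server 2 with probability `1 - p`. -/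
def model2Rate (lam mu α β p : ℝ) : ℕ × ℕ × Status → ℕ × ℕ × Status → ℝ≥0∞
  | (x, y, .up), (x', y', .up) =>
      (if x' = x ∧ y' = y + 1 then ENNReal.ofReal lam else 0) +
      (if x' = x + 1 ∧ y' + 1 = y then ENNReal.ofReal mu else 0) +
      (if x' + 1 = x ∧ y' = y then ENNReal.ofReal (mu * p) else 0) +
      (if x' + 1 = x ∧ y' = y + 1 then ENNReal.ofReal (mu * (1 - p)) else 0)
  | (x, y, .down), (x', y', .down) =>
      (if x' = x ∧ y' = y + 1 then ENNReal.ofReal lam else 0) +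
      (if x' = x + 1 ∧ y' + 1 = y then ENNReal.ofReal mu else 0)
  | (x, y, .up), (x', y', .down) => if x' = x ∧ y' = y then ENNReal.ofReal α else 0
  | (x, y, .down), (x', y', .up) => if x' = x ∧ y' = y then ENNReal.ofReal β else 0

end

/-! Uniformization writes `transProb q t` as a Poisson mixture, with mean `C t` and `C = maxRate q`,
of the powers of the stochastic matrix `K = unifStep q`. Everything reduces to the existence of a
`K`-invariant probability.

The Poisson law of mean `s` and its shift by one differ by at most `1 / √s`, so applying `K` once
more to `P_t` changes nothing in the limit and no periodicity question arises. If `K` is irreducible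
with invariant `π`, every ultrafilter limit of `P_t(·, y)` is thus bounded and harmonic, hence
constant, and integration against `π` identifies the constant as `π y` (`tendsto_transProb`).
Ergodicity and uniqueness of the stationary distribution follow. Conversely, the limit law of an
ergodic chain is `K`-invariant (`isInvariantMass_of_tendsto`).

Sufficiency: a Foster–Lyapunov criterion (`exists_isInvariantMass_of_drift`) with explicit Lyapunov
functions.

Necessity: bounded functions have zero mean drift in equilibrium (`IsInvariantMass.flux`). The
indicator of `down` shows that the server is up with probability `β / (α + β)`; the truncated number
of customers gives `lam ≤ mu * P(up and busy)`. The inequality becomes strict because the idle up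
state has positive mass. -/

open Filter

/-! ### Poisson weights -/

/-- The mass at `n` of the Poisson distribution with mean `s`. -/
noncomputable def poissonWeight (s : ℝ) (n : ℕ) : ℝ :=
  Real.exp (-s) * s ^ n / (n.factorial : ℝ)

theorem poissonWeight_nonneg {s : ℝ} (hs : 0 ≤ s) (n : ℕ) : 0 ≤ poissonWeight s n := by
  unfold poissonWeight; positivity

theorem poissonWeight_succ_mul (s : ℝ) (n : ℕ) :
    poissonWeight s (n + 1) * ((n : ℝ) + 1) = s * poissonWeight s n := by
  unfold poissonWeight
  rw [Nat.factorial_succ]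
  have : (n.factorial : ℝ) ≠ 0 := by positivity
  push_cast
  field_simp
  ring

theorem hasSum_poissonWeight (s : ℝ) : HasSum (poissonWeight s) 1 := by
  have h := (NormedSpace.expSeries_div_hasSum_exp (𝔸 := ℝ) s).mul_left (Real.exp (-s))
  rw [← Real.exp_eq_exp_ℝ, ← Real.exp_add, neg_add_cancel, Real.exp_zero] at h
  exact h.congr_fun fun n => (mul_div_assoc _ _ _)

theorem hasSum_poissonWeight_mul (s : ℝ) : HasSum (fun n : ℕ => poissonWeight s n * (n : ℝ)) s := by
  rw [hasSum_nat_add_iff' 1 |>.symm]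
  simpa [poissonWeight_succ_mul] using (hasSum_poissonWeight s).mul_left s

theorem hasSum_poissonWeight_mul_sub_one (s : ℝ) :
    HasSum (fun n : ℕ => poissonWeight s n * ((n : ℝ) * (n - 1))) (s ^ 2) := by
  rw [hasSum_nat_add_iff' 1 |>.symm]
  have h := (hasSum_poissonWeight_mul s).mul_left s
  have e : (fun n : ℕ => s * (poissonWeight s n * (n : ℝ))) =
      fun n : ℕ => poissonWeight s (n + 1) * (((n + 1 : ℕ) : ℝ) * (((n + 1 : ℕ) : ℝ) - 1)) := by
    ext n
    push_cast
    rw [← mul_assoc s, ← poissonWeight_succ_mul]; ring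
  rw [e] at h
  simpa [sq] using h

/-- Expand `(1 - n/s)^2 = 1 + (1/s^2 - 2/s) n + n(n-1)/s^2` and use the factorial moments. -/
theorem hasSum_poissonWeight_variance {s : ℝ} (hs : 0 < s) :
    HasSum (fun n : ℕ => poissonWeight s n * (1 - (n : ℝ) / s) ^ 2) (1 / s) := by
  have h := ((hasSum_poissonWeight s).add ((hasSum_poissonWeight_mul s).mul_left (1 / s ^ 2 - 2 / s))).add
    ((hasSum_poissonWeight_mul_sub_one s).mul_left (1 / s ^ 2))
  convert h using 1
  · ext n
    field_simp
    ring
  · field_simp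
    ring

/-- The total variation distance (up to a factor) between the Poisson distribution with mean `s`
and its shift by one. -/
noncomputable def poissonShiftDist (s : ℝ) : ℝ≥0∞ :=
  ∑' n : ℕ, ENNReal.ofReal (poissonWeight s n * |1 - (n : ℝ) / s|)

/-- The bound `2|z| ≤ √s z^2 + 1/√s` with `z = 1 - n/s` reduces the mean absolute deviation to the
variance `1/s`. -/
theorem poissonShiftDist_le {s : ℝ} (hs : 0 < s) :
    poissonShiftDist s ≤ ENNReal.ofReal (1 / √s) := by
  have h2 : HasSum (fun n : ℕ => poissonWeight s n * ((√s * (1 - (n : ℝ) / s) ^ 2 + 1 / √s) / 2))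
      (1 / √s) := by
    have h := ((hasSum_poissonWeight_variance hs).mul_left (√s / 2)).add
      ((hasSum_poissonWeight s).mul_left (1 / √s / 2))
    have e : 1 / √s = √s / 2 * (1 / s) + 1 / √s / 2 * 1 := by
      have h3 : √s ≠ 0 := (Real.sqrt_pos.2 hs).ne'
      have h4 : √s * (1 / s) = 1 / √s := by
        rw [mul_one_div, div_eq_div_iff hs.ne' h3, Real.mul_self_sqrt hs.le, one_mul]
      linear_combination (-(1 / 2 : ℝ)) * h4
    rw [← e] at h
    exact h.congr_fun fun n => by ring
  rw [← h2.tsum_eq, ENNReal.ofReal_tsum_of_nonneg _ h2.summable]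
  · refine ENNReal.tsum_le_tsum fun n => ENNReal.ofReal_le_ofReal ?_
    refine mul_le_mul_of_nonneg_left ?_ (poissonWeight_nonneg hs.le n)
    have h3 : 0 < √s := Real.sqrt_pos.2 hs
    have h4 := sq_nonneg (√s * |1 - (n : ℝ) / s| - 1)
    rw [← sq_abs (1 - (n : ℝ) / s)]
    rw [le_div_iff₀ two_pos, ← mul_le_mul_iff_left₀ h3]
    have : (√s * |1 - (n : ℝ) / s| ^ 2 + 1 / √s) * √s = √s ^ 2 * |1 - (n : ℝ) / s| ^ 2 + 1 := by
      field_simp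
    rw [this]
    nlinarith
  · intro n
    exact mul_nonneg (poissonWeight_nonneg hs.le n) (by positivity)

theorem tendsto_poissonShiftDist : Tendsto poissonShiftDist atTop (𝓝 0) := by
  have h : Tendsto (fun s : ℝ => ENNReal.ofReal (1 / √s)) atTop (𝓝 0) := by
    rw [← ENNReal.ofReal_zero]
    refine ENNReal.tendsto_ofReal ?_
    simp only [one_div]
    exact tendsto_inv_atTop_zero.comp Real.tendsto_sqrt_atTop
  refine tendsto_of_tendsto_of_tendsto_of_le_of_le' tendsto_const_nhds h
    (Eventually.of_forall fun _ => zero_le) ?_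
  filter_upwards [eventually_gt_atTop 0] with s hs using poissonShiftDist_le hs

theorem poissonWeight_sub_succ {s : ℝ} (hs : 0 < s) (n : ℕ) :
    poissonWeight s n - poissonWeight s (n + 1) =
      -(poissonWeight s (n + 1) * (1 - ((n + 1 : ℕ) : ℝ) / s)) := by
  have := poissonWeight_succ_mul s n
  push_cast
  field_simp
  linarith

theorem tsum_poissonWeight_mul_succ_le {s : ℝ} (hs : 0 < s) {a : ℕ → ℝ≥0∞} (ha : ∀ n, a n ≤ 1) :
    ∑' n, ENNReal.ofReal (poissonWeight s n) * a (n + 1) ≤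
      ∑' n, ENNReal.ofReal (poissonWeight s n) * a n + poissonShiftDist s := by
  have key : ∀ n, ENNReal.ofReal (poissonWeight s n) * a (n + 1) ≤
      ENNReal.ofReal (poissonWeight s (n + 1)) * a (n + 1) +
        ENNReal.ofReal (poissonWeight s (n + 1) * |1 - ((n + 1 : ℕ) : ℝ) / s|) := by
    intro n
    have hw := poissonWeight_nonneg hs.le (n + 1)
    calc _ ≤ (ENNReal.ofReal (poissonWeight s (n + 1)) +
          ENNReal.ofReal (poissonWeight s (n + 1) * |1 - ((n + 1 : ℕ) : ℝ) / s|)) * a (n + 1) := by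
          gcongr
          rw [← ENNReal.ofReal_add hw (by positivity)]
          refine ENNReal.ofReal_le_ofReal ?_
          have h1 := poissonWeight_sub_succ hs n
          have h2 := mul_le_mul_of_nonneg_left (neg_abs_le (1 - ((n + 1 : ℕ) : ℝ) / s)) hw
          linarith
      _ ≤ _ := by
          rw [add_mul]
          gcongr
          exact mul_le_of_le_one_right zero_le (ha _)
  calc _ ≤ _ := ENNReal.tsum_le_tsum key
    _ = _ := ENNReal.tsum_add
    _ ≤ _ := add_le_add
        (ENNReal.tsum_comp_le_tsum_of_injective (add_left_injective 1)
          fun n => ENNReal.ofReal (poissonWeight s n) * a n)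
        (ENNReal.tsum_comp_le_tsum_of_injective (add_left_injective 1)
          fun n : ℕ => ENNReal.ofReal (poissonWeight s n * |1 - (n : ℝ) / s|))

theorem tsum_poissonWeight_mul_le_succ {s : ℝ} (hs : 0 < s) {a : ℕ → ℝ≥0∞} (ha : ∀ n, a n ≤ 1) :
    ∑' n, ENNReal.ofReal (poissonWeight s n) * a n ≤
      ∑' n, ENNReal.ofReal (poissonWeight s n) * a (n + 1) + poissonShiftDist s := by
  have key : ∀ n, ENNReal.ofReal (poissonWeight s (n + 1)) * a (n + 1) ≤
      ENNReal.ofReal (poissonWeight s n) * a (n + 1) +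
        ENNReal.ofReal (poissonWeight s (n + 1) * |1 - ((n + 1 : ℕ) : ℝ) / s|) := by
    intro n
    have hw := poissonWeight_nonneg hs.le (n + 1)
    calc _ ≤ (ENNReal.ofReal (poissonWeight s n) +
          ENNReal.ofReal (poissonWeight s (n + 1) * |1 - ((n + 1 : ℕ) : ℝ) / s|)) * a (n + 1) := by
          gcongr
          rw [← ENNReal.ofReal_add (poissonWeight_nonneg hs.le n) (by positivity)]
          refine ENNReal.ofReal_le_ofReal ?_
          have h1 := poissonWeight_sub_succ hs n
          have h2 := mul_le_mul_of_nonneg_left (le_abs_self (1 - ((n + 1 : ℕ) : ℝ) / s)) hw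
          linarith
      _ ≤ _ := by
          rw [add_mul]
          gcongr
          exact mul_le_of_le_one_right zero_le (ha _)
  -- The term `n = 0` has no partner in the shifted sum. It is absorbed by the term `n = 0` of
  -- `poissonShiftDist`, which is the full weight of `0`.
  have e1 := tsum_eq_zero_add' (f := fun n => ENNReal.ofReal (poissonWeight s n) * a n)
    ENNReal.summable
  have e2 := tsum_eq_zero_add'
    (f := fun n : ℕ => ENNReal.ofReal (poissonWeight s n * |1 - (n : ℝ) / s|)) ENNReal.summable
  rw [e1, poissonShiftDist, e2, add_left_comm, ← ENNReal.tsum_add]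
  refine add_le_add ?_ (ENNReal.tsum_le_tsum key)
  simpa using mul_le_of_le_one_right zero_le (ha 0)

/-! ### The uniformized chain -/

section Chain

variable {E : Type*} {q : E → E → ℝ≥0∞}

theorem exitRate_le_maxRate (q : E → E → ℝ≥0∞) (x : E) : exitRate q x ≤ maxRate q :=
  le_iSup (exitRate q) x

theorem exitRate_div_maxRate_le_one (q : E → E → ℝ≥0∞) (x : E) :
    exitRate q x / maxRate q ≤ 1 :=
  ENNReal.div_le_of_le_mul (by simpa using exitRate_le_maxRate q x)

/-- The rates are bounded and not all zero. -/
structure RegularRates (q : E → E → ℝ≥0∞) : Prop where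
  ne_zero : maxRate q ≠ 0
  ne_top : maxRate q ≠ ⊤

theorem RegularRates.toReal_pos (hq : RegularRates q) : 0 < (maxRate q).toReal :=
  ENNReal.toReal_pos hq.ne_zero hq.ne_top

theorem RegularRates.tendsto_shiftDist (hq : RegularRates q) :
    Tendsto (fun t : ℝ≥0 => poissonShiftDist ((maxRate q).toReal * t)) atTop (𝓝 0) :=
  tendsto_poissonShiftDist.comp
    ((NNReal.tendsto_coe_atTop.2 tendsto_id).const_mul_atTop hq.toReal_pos)

variable [DecidableEq E]

theorem tsum_unifStep_mul (x : E) (f : E → ℝ≥0∞) :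
    ∑' y, unifStep q x y * f y =
      (∑' y, q x y * f y) / maxRate q + (1 - exitRate q x / maxRate q) * f x := by
  simp only [unifStep, add_mul, ENNReal.tsum_add, ite_mul, zero_mul, tsum_ite_eq]
  simp only [div_eq_mul_inv, ← ENNReal.tsum_mul_right]
  congr 2
  ext y
  ring

theorem tsum_unifStep (x : E) : ∑' y, unifStep q x y = 1 := by
  have h := tsum_unifStep_mul (q := q) x 1
  simp only [Pi.one_apply, mul_one] at h
  rw [h]
  exact add_tsub_cancel_of_le (exitRate_div_maxRate_le_one q x)

theorem tsum_unifSteps (n : ℕ) (x : E) : ∑' y, unifSteps q n x y = 1 := by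
  induction n with
  | zero => simp [unifSteps]
  | succ n ih =>
    simp only [unifSteps]
    rw [ENNReal.tsum_comm]
    simp [ENNReal.tsum_mul_left, tsum_unifStep, ih]

theorem unifSteps_le_one (n : ℕ) (x y : E) : unifSteps q n x y ≤ 1 :=
  (tsum_unifSteps (q := q) n x) ▸ ENNReal.le_tsum y

theorem unifSteps_succ_left (n : ℕ) (x y : E) :
    unifSteps q (n + 1) x y = ∑' z, unifStep q x z * unifSteps q n z y := by
  induction n generalizing y with
  | zero => simp [unifSteps, ite_mul, mul_ite, eq_comm]
  | succ n ih =>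
    rw [unifSteps]
    simp only [ih, ← ENNReal.tsum_mul_right]
    rw [ENNReal.tsum_comm]
    refine tsum_congr fun z => ?_
    rw [unifSteps, ← ENNReal.tsum_mul_left]
    exact tsum_congr fun w => mul_assoc _ _ _

theorem transProb_eq (q : E → E → ℝ≥0∞) (t : ℝ≥0) (x y : E) :
    transProb q t x y =
      ∑' n, ENNReal.ofReal (poissonWeight ((maxRate q).toReal * t) n) * unifSteps q n x y := rfl

theorem tsum_ofReal_poissonWeight {s : ℝ} (hs : 0 ≤ s) :
    ∑' n, ENNReal.ofReal (poissonWeight s n) = 1 := by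
  rw [← ENNReal.ofReal_tsum_of_nonneg (poissonWeight_nonneg hs) (hasSum_poissonWeight s).summable,
    (hasSum_poissonWeight s).tsum_eq, ENNReal.ofReal_one]

theorem transProb_le_one (t : ℝ≥0) (x y : E) : transProb q t x y ≤ 1 := by
  rw [transProb_eq, ← tsum_ofReal_poissonWeight (s := (maxRate q).toReal * t) (by positivity)]
  exact ENNReal.tsum_le_tsum fun n => mul_le_of_le_one_right zero_le (unifSteps_le_one n x y)

/-- An extra step of `K`, on either side, shifts the index of the Poisson mixture by one;
`poissonShiftDist` then measures the change. -/
theorem tsum_unifStep_mul_transProb (t : ℝ≥0) (x y : E) :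
    ∑' z, unifStep q x z * transProb q t z y =
      ∑' n, ENNReal.ofReal (poissonWeight ((maxRate q).toReal * t) n) *
        unifSteps q (n + 1) x y := by
  simp only [transProb_eq, unifSteps_succ_left, ← ENNReal.tsum_mul_left]
  rw [ENNReal.tsum_comm]
  exact tsum_congr fun n => tsum_congr fun z => by ring

theorem tsum_transProb_mul_unifStep (t : ℝ≥0) (x y : E) :
    ∑' z, transProb q t x z * unifStep q z y =
      ∑' n, ENNReal.ofReal (poissonWeight ((maxRate q).toReal * t) n) *
        unifSteps q (n + 1) x y := by
  simp only [transProb_eq, unifSteps, ← ENNReal.tsum_mul_left, ← ENNReal.tsum_mul_right]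
  rw [ENNReal.tsum_comm]
  exact tsum_congr fun n => tsum_congr fun z => by ring

/-! ### Invariant masses -/

/-- `π` is invariant under the uniformized chain. -/
def IsInvariantMass (q : E → E → ℝ≥0∞) (π : E → ℝ≥0∞) : Prop :=
  ∀ y, ∑' x, π x * unifStep q x y = π y

theorem IsInvariantMass.unifSteps {π : E → ℝ≥0∞} (h : IsInvariantMass q π) (n : ℕ) (y : E) :
    ∑' x, π x * unifSteps q n x y = π y := by
  induction n generalizing y with
  | zero => simp [_root_.unifSteps]
  | succ n ih =>
    simp only [_root_.unifSteps, ← ENNReal.tsum_mul_left]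
    rw [ENNReal.tsum_comm, ← h y]
    refine tsum_congr fun z => ?_
    rw [← ih z, ← ENNReal.tsum_mul_right]
    exact tsum_congr fun w => by ring

theorem IsInvariantMass.transProb {π : E → ℝ≥0∞} (h : IsInvariantMass q π) (t : ℝ≥0) (y : E) :
    ∑' x, π x * transProb q t x y = π y := by
  simp only [transProb_eq, ← ENNReal.tsum_mul_left]
  rw [ENNReal.tsum_comm]
  have : ∀ n, ∑' x, π x * (ENNReal.ofReal (poissonWeight ((maxRate q).toReal * t) n) *
      _root_.unifSteps q n x y) = ENNReal.ofReal (poissonWeight ((maxRate q).toReal * t) n) * π y := by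
    intro n
    rw [← h.unifSteps n y, ← ENNReal.tsum_mul_left]
    exact tsum_congr fun z => by ring
  simp only [this, ENNReal.tsum_mul_right]
  rw [tsum_ofReal_poissonWeight (by positivity), one_mul]

theorem eq_of_le_of_tsum_eq {ι : Type*} {f g : ι → ℝ≥0∞} (hle : ∀ i, f i ≤ g i)
    (hsum : ∑' i, f i = ∑' i, g i) (hfin : ∑' i, f i ≠ ⊤) (i : ι) : f i = g i := by
  by_contra hne
  exact (ENNReal.tsum_lt_tsum hfin hle (lt_of_le_of_ne (hle i) hne)).ne hsum

/-- `K` preserves total mass, so a subinvariant finite mass cannot lose anything at any point. This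
makes the one-sided bounds from Fatou's lemma sufficient. -/
theorem isInvariantMass_of_le {π : E → ℝ≥0∞} (hfin : ∑' x, π x ≠ ⊤)
    (h : ∀ y, ∑' x, π x * unifStep q x y ≤ π y) : IsInvariantMass q π := by
  have hs : ∑' y, ∑' x, π x * unifStep q x y = ∑' y, π y := by
    rw [ENNReal.tsum_comm]
    simp [ENNReal.tsum_mul_left, tsum_unifStep]
  exact eq_of_le_of_tsum_eq h hs (hs ▸ hfin)

/-! ### Limits of sums -/

/-- Fatou's lemma for sums along an arbitrary filter. -/
theorem tsum_mul_le_of_tendsto {ι κ : Type*} {l : Filter κ} [l.NeBot] {a : κ → ι → ℝ≥0∞}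
    {b w : ι → ℝ≥0∞} {c : κ → ℝ≥0∞} {d : ℝ≥0∞} (ha : ∀ i, Tendsto (fun k => a k i) l (𝓝 (b i)))
    (hw : ∀ i, w i ≠ ⊤) (hle : ∀ᶠ k in l, ∑' i, a k i * w i ≤ c k) (hc : Tendsto c l (𝓝 d)) :
    ∑' i, b i * w i ≤ d := by
  rw [ENNReal.tsum_eq_iSup_sum]
  refine iSup_le fun s => ?_
  have h1 : Tendsto (fun k => ∑ i ∈ s, a k i * w i) l (𝓝 (∑ i ∈ s, b i * w i)) :=
    tendsto_finsetSum _ fun i _ => ENNReal.Tendsto.mul_const (ha i) (Or.inr (hw i))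
  refine le_of_tendsto_of_tendsto h1 hc ?_
  filter_upwards [hle] with k hk using (ENNReal.sum_le_tsum s).trans hk

/-- Dominated convergence for sums against finite weights along an arbitrary filter. -/
theorem tendsto_tsum_mul {ι κ : Type*} {l : Filter κ} {w b : ι → ℝ≥0∞} {a : κ → ι → ℝ≥0∞}
    (hw : ∑' i, w i ≠ ⊤) (ha1 : ∀ k i, a k i ≤ 1)
    (ha : ∀ i, Tendsto (fun k => a k i) l (𝓝 (b i))) :
    Tendsto (fun k => ∑' i, w i * a k i) l (𝓝 (∑' i, w i * b i)) := by
  rcases l.eq_or_neBot with rfl | hl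
  · simp
  have hb1 : ∀ i, b i ≤ 1 := fun i => le_of_tendsto' (ha i) fun k => ha1 k i
  have hwi : ∀ i, w i ≠ ⊤ := fun i => ENNReal.ne_top_of_tsum_ne_top hw i
  have hlt : ∀ u : ι → ℝ≥0∞, (∀ i, u i ≤ 1) → ∑' i, w i * u i ≠ ⊤ := fun u hu =>
    ne_top_of_le_ne_top hw (ENNReal.tsum_le_tsum fun i => mul_le_of_le_one_right zero_le (hu i))
  rw [← ENNReal.tendsto_toReal_iff (fun k => hlt _ (ha1 k)) (hlt _ hb1)]
  have e : ∀ u : ι → ℝ≥0∞, (∀ i, u i ≤ 1) →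
      (∑' i, w i * u i).toReal = ∑' i, (w i * u i).toReal := fun u hu =>
    ENNReal.tsum_toReal_eq fun i => ENNReal.ne_top_of_tsum_ne_top (hlt u hu) i
  simp only [e _ (ha1 _), e _ hb1]
  refine tendsto_tsum_of_dominated_convergence (bound := fun i => (w i).toReal)
    (ENNReal.summable_toReal hw) ?_ ?_
  · intro i
    rw [ENNReal.tendsto_toReal_iff]
    · exact ENNReal.Tendsto.const_mul (ha i) (Or.inr (hwi i))
    · exact fun k => ENNReal.mul_ne_top (hwi i) (ne_top_of_le_ne_top ENNReal.one_ne_top (ha1 k i))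
    · exact ENNReal.mul_ne_top (hwi i) (ne_top_of_le_ne_top ENNReal.one_ne_top (hb1 i))
  · refine Eventually.of_forall fun k i => ?_
    rw [Real.norm_of_nonneg ENNReal.toReal_nonneg]
    exact ENNReal.toReal_mono (hwi i) (mul_le_of_le_one_right zero_le (ha1 k i))

/-! ### Harmonic functions and convergence -/

/-- Irreducibility of the uniformized chain. -/
def IsIrreducibleUnif (q : E → E → ℝ≥0∞) : Prop :=
  ∀ x y, ∃ n, unifSteps q n x y ≠ 0

theorem IsInvariantMass.pos (hirr : IsIrreducibleUnif q) {π : PMF E} (h : IsInvariantMass q π) (y : E) :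
    π y ≠ 0 := by
  obtain ⟨x, hx⟩ := π.support_nonempty
  obtain ⟨n, hn⟩ := hirr x y
  rw [← h.unifSteps n y]
  refine ne_of_gt (lt_of_lt_of_le ?_ (ENNReal.le_tsum x))
  exact pos_iff_ne_zero.2 (mul_ne_zero hx hn)

/-- A bounded superharmonic function is harmonic for a chain with a positive invariant
distribution. -/
theorem harmonic_of_superharmonic {π : PMF E} (h : IsInvariantMass q π) (hpos : ∀ x, π x ≠ 0)
    {g : E → ℝ≥0∞} (hg1 : ∀ x, g x ≤ 1) (hg : ∀ x, ∑' y, unifStep q x y * g y ≤ g x) (x : E) :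
    ∑' y, unifStep q x y * g y = g x := by
  -- By invariance `K g` and `g` have the same `π`-mean, so the pointwise inequality is an equality
  -- wherever `π` is positive.
  have hs : ∑' x, π x * ∑' y, unifStep q x y * g y = ∑' y, π y * g y := by
    simp only [← ENNReal.tsum_mul_left]
    rw [ENNReal.tsum_comm]
    refine tsum_congr fun y => ?_
    rw [← h y, ← ENNReal.tsum_mul_right]
    exact tsum_congr fun w => by ring
  have hfin : ∑' y, π y * g y ≠ ⊤ :=
    ne_top_of_le_ne_top (b := ∑' y, π y) (by simp) (ENNReal.tsum_le_tsum fun i =>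
      mul_le_of_le_one_right zero_le (hg1 i))
  have := eq_of_le_of_tsum_eq (fun x => mul_le_mul_right (hg x) (π x)) hs (hs ▸ hfin) x
  exact (ENNReal.mul_right_inj (hpos x) (π.apply_ne_top x)).1 this

/-- A bounded harmonic function of an irreducible positive recurrent chain is constant. -/
theorem eq_of_harmonic (hirr : IsIrreducibleUnif q) {π : PMF E} (h : IsInvariantMass q π)
    {g : E → ℝ≥0∞} (hg1 : ∀ x, g x ≤ 1) (hg : ∀ x, ∑' y, unifStep q x y * g y = g x) (x y : E) :
    g x ≤ g y := by
  -- Truncating `g` at its value at `x` gives a superharmonic, hence harmonic, function that attains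
  -- its maximum at `x`. By the maximum principle it equals this maximum at every state reachable
  -- from `x`.
  have hmin : ∀ z, ∑' y, unifStep q z y * min (g y) (g x) = min (g z) (g x) := by
    refine harmonic_of_superharmonic h (h.pos hirr) (fun z => min_le_of_left_le (hg1 z)) fun z => ?_
    refine le_min ?_ ?_
    · rw [← hg z]
      exact ENNReal.tsum_le_tsum fun y => by gcongr; exact min_le_left _ _
    · calc _ ≤ ∑' y, unifStep q z y * g x :=
            ENNReal.tsum_le_tsum fun y => by gcongr; exact min_le_right _ _
        _ = g x := by rw [ENNReal.tsum_mul_right, tsum_unifStep, one_mul]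
  have hn : ∀ n z, ∑' y, unifSteps q n z y * min (g y) (g x) = min (g z) (g x) := by
    intro n
    induction n with
    | zero => intro z; simp [unifSteps]
    | succ n ih =>
      intro z
      simp only [unifSteps, ← ENNReal.tsum_mul_right]
      rw [ENNReal.tsum_comm, ← ih z]
      refine tsum_congr fun w => ?_
      rw [← hmin w, ← ENNReal.tsum_mul_left]
      exact tsum_congr fun v => by ring
  obtain ⟨n, hxy⟩ := hirr x y
  have hx := hn n x
  simp only [min_self] at hx
  have hgx : g x ≠ ⊤ := ne_top_of_le_ne_top ENNReal.one_ne_top (hg1 x)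
  have hsum : ∑' y, unifSteps q n x y * min (g y) (g x) = ∑' y, unifSteps q n x y * g x := by
    rw [hx, ENNReal.tsum_mul_right, tsum_unifSteps, one_mul]
  have := eq_of_le_of_tsum_eq (fun y => mul_le_mul_right (min_le_right (g y) (g x)) _) hsum
    (by rw [hx]; exact hgx) y
  have := (ENNReal.mul_right_inj hxy
    (ne_top_of_le_ne_top ENNReal.one_ne_top (unifSteps_le_one n x y))).1 this
  exact min_eq_right_iff.1 this

/-- Convergence to the invariant distribution. -/
theorem tendsto_transProb (hq : RegularRates q) (hirr : IsIrreducibleUnif q) {π : PMF E}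
    (h : IsInvariantMass q π) (x y : E) :
    Tendsto (fun t => transProb q t x y) atTop (𝓝 (π y)) := by
  -- Along an ultrafilter all limits exist by compactness of `[0, ∞]`; it remains to show that the
  -- limit does not depend on the ultrafilter.
  rw [tendsto_iff_ultrafilter]
  intro U hU
  set g : E → ℝ≥0∞ := fun z => (U.map fun t => transProb q t z y).lim with hgdef
  have hg : ∀ z, Tendsto (fun t => transProb q t z y) U (𝓝 (g z)) := fun z =>
    (U.map fun t => transProb q t z y).le_nhds_lim
  have hg1 : ∀ z, g z ≤ 1 := fun z => le_of_tendsto' (hg z) fun t => transProb_le_one t z y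
  have hδ := hq.tendsto_shiftDist.mono_left hU
  have hpos : ∀ᶠ t : ℝ≥0 in U, 0 < (maxRate q).toReal * (t : ℝ) := by
    filter_upwards [hU (eventually_gt_atTop 0)] with t ht
    exact mul_pos hq.toReal_pos (NNReal.coe_pos.2 ht)
  have hharm : ∀ z, ∑' w, unifStep q z w * g w = g z := by
    intro z
    have hlim := tendsto_tsum_mul (w := unifStep q z) (l := (U : Filter ℝ≥0))
      (by rw [tsum_unifStep]; exact ENNReal.one_ne_top)
      (fun t w => transProb_le_one t w y) hg
    refine le_antisymm ?_ ?_
    · refine le_of_tendsto_of_tendsto hlim (by simpa using (hg z).add hδ) ?_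
      filter_upwards [hpos] with t ht
      rw [tsum_unifStep_mul_transProb]
      exact tsum_poissonWeight_mul_succ_le ht fun n => unifSteps_le_one n z y
    · refine le_of_tendsto_of_tendsto (hg z) (by simpa using hlim.add hδ) ?_
      filter_upwards [hpos] with t ht
      rw [tsum_unifStep_mul_transProb]
      exact tsum_poissonWeight_mul_le_succ ht fun n => unifSteps_le_one n z y
  have hconst : ∀ z, g z = g x := fun z =>
    le_antisymm (eq_of_harmonic hirr h hg1 hharm z x) (eq_of_harmonic hirr h hg1 hharm x z)
  -- The `π`-mean of `P_t(·, y)` is `π y` for all `t`, so the constant limit must be `π y`.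
  have hlim := tendsto_tsum_mul (w := π) (l := (U : Filter ℝ≥0)) (by simp)
      (fun t w => transProb_le_one t w y) hg
  simp only [h.transProb, hconst, ENNReal.tsum_mul_right, π.tsum_coe, one_mul] at hlim
  rw [tendsto_nhds_unique tendsto_const_nhds hlim]
  exact hg x

/-- A limit of the transition probabilities is invariant. -/
theorem isInvariantMass_of_tendsto (hq : RegularRates q) {π : PMF E} {x : E}
    (h : ∀ y, Tendsto (fun t => transProb q t x y) atTop (𝓝 (π y))) : IsInvariantMass q π := by
  refine isInvariantMass_of_le (by simp) fun y => ?_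
  refine tsum_mul_le_of_tendsto h (fun i => ?_) ?_ (by simpa using (h y).add hq.tendsto_shiftDist)
  · exact ENNReal.ne_top_of_tsum_ne_top (by rw [tsum_unifStep]; exact ENNReal.one_ne_top) y
  · filter_upwards [eventually_gt_atTop 0] with t ht
    rw [tsum_transProb_mul_unifStep]
    exact tsum_poissonWeight_mul_succ_le (mul_pos hq.toReal_pos (NNReal.coe_pos.2 ht))
      fun n => unifSteps_le_one n x y

/-! ### Irreducibility -/

theorem unifStep_ne_zero (hq : RegularRates q) {x y : E} (h : q x y ≠ 0) :
    unifStep q x y ≠ 0 := by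
  unfold unifStep
  exact ne_of_gt (lt_of_lt_of_le (ENNReal.div_pos h hq.ne_top) le_self_add)

theorem exists_unifSteps_ne_zero (hq : RegularRates q) {x y : E}
    (h : Relation.ReflTransGen (fun a b => q a b ≠ 0) x y) : ∃ n, unifSteps q n x y ≠ 0 := by
  induction h with
  | refl => exact ⟨0, by simp [unifSteps]⟩
  | @tail y z _ hyz ih =>
    obtain ⟨n, hn⟩ := ih
    refine ⟨n + 1, ne_of_gt (lt_of_lt_of_le ?_ (ENNReal.le_tsum y))⟩
    exact pos_iff_ne_zero.2 (mul_ne_zero hn (unifStep_ne_zero hq hyz))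

theorem isIrreducibleUnif_of_reachable (hq : RegularRates q) (o : E)
    (hto : ∀ x, Relation.ReflTransGen (fun a b => q a b ≠ 0) x o)
    (hfrom : ∀ x, Relation.ReflTransGen (fun a b => q a b ≠ 0) o x) : IsIrreducibleUnif q :=
  fun x y => exists_unifSteps_ne_zero hq ((hto x).trans (hfrom y))

theorem isIrreducibleChain_transProb (hq : RegularRates q) (hirr : IsIrreducibleUnif q) :
    IsIrreducibleChain (transProb q) := by
  intro x y
  obtain ⟨n, hn⟩ := hirr x y
  refine ⟨1, lt_of_lt_of_le ?_ (ENNReal.le_tsum n)⟩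
  refine pos_iff_ne_zero.2 (mul_ne_zero ?_ hn)
  have := hq.toReal_pos
  simp only [ne_eq, ENNReal.ofReal_eq_zero, not_le]
  push_cast
  positivity

/-! ### The Foster–Lyapunov criterion -/

/-- A Lyapunov function with negative drift off a finite set yields an invariant distribution. -/
theorem exists_isInvariantMass_of_drift (hq : RegularRates q) [Nonempty E] {V : E → ℝ≥0∞}
    (hV : ∀ x, V x ≠ ⊤) (F : Finset E) {ε b : ℝ≥0∞} (hε : ε ≠ 0) (hb : b ≠ ⊤)
    (hdrift : ∀ x, ∑' y, q x y * V y + ε ≤ exitRate q x * V x + if x ∈ F then b else 0) :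
    ∃ π : PMF E, IsInvariantMass q π := by
  obtain ⟨o⟩ := ‹Nonempty E›
  set C := maxRate q with hC
  -- The drift condition in units of one uniformized step.
  have hstep : ∀ x, ∑' y, unifStep q x y * V y + ε / C ≤ V x + if x ∈ F then b / C else 0 := by
    intro x
    have h1 : (exitRate q x / C) * V x + (1 - exitRate q x / C) * V x = V x := by
      rw [← add_mul, add_tsub_cancel_of_le (exitRate_div_maxRate_le_one q x), one_mul]
    have h2 := ENNReal.div_le_div_right (hdrift x) C
    rw [ENNReal.add_div, ENNReal.add_div] at h2
    have h3 : (if x ∈ F then b else 0) / C = if x ∈ F then b / C else 0 := by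
      split_ifs <;> simp
    have h4 : exitRate q x * V x / C = exitRate q x / C * V x := by
      simp only [div_eq_mul_inv]; ring
    rw [h3, h4] at h2
    rw [tsum_unifStep_mul]
    calc _ = (∑' y, q x y * V y) / C + ε / C + (1 - exitRate q x / C) * V x := by ring
      _ ≤ _ := add_le_add_left h2 _
      _ = _ := by rw [add_right_comm, h1]
  -- `S N y` is the expected number of visits to `y` before step `N`, starting from `o`.
  set S : ℕ → E → ℝ≥0∞ := fun N y => ∑ n ∈ Finset.range N, unifSteps q n o y with hS
  have hiter : ∀ N : ℕ, ∑' y, unifSteps q N o y * V y + N * (ε / C) ≤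
      V o + (b / C) * ∑ y ∈ F, S N y := by
    intro N
    induction N with
    | zero => simp [unifSteps]
    | succ N ih =>
      have h1 : ∑' y, unifSteps q (N + 1) o y * V y + ε / C ≤
          ∑' y, unifSteps q N o y * V y + (b / C) * ∑ y ∈ F, unifSteps q N o y := by
        have e1 : ∑' y, unifSteps q (N + 1) o y * V y =
            ∑' z, unifSteps q N o z * ∑' y, unifStep q z y * V y := by
          simp only [unifSteps, ← ENNReal.tsum_mul_right, ← ENNReal.tsum_mul_left]
          rw [ENNReal.tsum_comm]
          simp only [mul_assoc]
        have e2 : ε / C = ∑' z, unifSteps q N o z * (ε / C) := by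
          rw [ENNReal.tsum_mul_right, tsum_unifSteps, one_mul]
        have e3 : (b / C) * ∑ y ∈ F, unifSteps q N o y =
            ∑' y, unifSteps q N o y * if y ∈ F then b / C else 0 := by
          rw [tsum_eq_sum (s := F) (by intro y hy; simp [hy]), Finset.mul_sum]
          exact Finset.sum_congr rfl fun y hy => by simp [hy, mul_comm]
        rw [e1, e3]
        conv_lhs => rw [e2]
        rw [← ENNReal.tsum_add, ← ENNReal.tsum_add]
        refine ENNReal.tsum_le_tsum fun z => ?_
        rw [← mul_add, ← mul_add]
        exact mul_le_mul_right (hstep z) _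
      have e4 : ∑ y ∈ F, S (N + 1) y = ∑ y ∈ F, S N y + ∑ y ∈ F, unifSteps q N o y := by
        rw [← Finset.sum_add_distrib]
        exact Finset.sum_congr rfl fun y _ => Finset.sum_range_succ _ _
      rw [e4]
      calc _ = ∑' y, unifSteps q (N + 1) o y * V y + ε / C + N * (ε / C) := by push_cast; ring
        _ ≤ ∑' y, unifSteps q N o y * V y + (b / C) * ∑ y ∈ F, unifSteps q N o y + N * (ε / C) :=
          add_le_add_left h1 _
        _ = ∑' y, unifSteps q N o y * V y + N * (ε / C) + (b / C) * ∑ y ∈ F, unifSteps q N o y := by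
          ring
        _ ≤ _ := add_le_add_left ih _
        _ = _ := by ring
  let U : Ultrafilter ℕ := Ultrafilter.of atTop
  have hU : (U : Filter ℕ) ≤ atTop := Ultrafilter.of_le atTop
  -- The candidate is an ultrafilter limit of mean occupation measures. Mass may escape to infinity,
  -- so only total mass at most `1` is automatic.
  set m : E → ℝ≥0∞ := fun y => (U.map fun N => S N y / N).lim with hm
  have hmlim : ∀ y, Tendsto (fun N => S N y / N) U (𝓝 (m y)) := fun y =>
    (U.map fun N => S N y / N).le_nhds_lim
  have hinv : Tendsto (fun N : ℕ => (N : ℝ≥0∞)⁻¹) U (𝓝 0) :=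
    ENNReal.tendsto_inv_nat_nhds_zero.mono_left hU
  have hN : ∀ᶠ N : ℕ in U, N ≠ 0 := hU (eventually_ne_atTop 0)
  have hSsum : ∀ N : ℕ, ∑' y, S N y = N := by
    intro N
    simp only [hS]
    rw [Summable.tsum_finsetSum fun _ _ => ENNReal.summable]
    simp [tsum_unifSteps]
  have hmle : ∑' y, m y ≤ 1 := by
    have := tsum_mul_le_of_tendsto (w := fun _ => 1) (c := fun _ => 1) hmlim (by simp) ?_
      tendsto_const_nhds
    · simpa using this
    · filter_upwards [hN] with N hN
      simp only [mul_one, div_eq_mul_inv, ENNReal.tsum_mul_right, hSsum]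
      rw [ENNReal.mul_inv_cancel (by exact_mod_cast hN) (by simp)]
  have hmfin : ∑' y, m y ≠ ⊤ := ne_top_of_le_ne_top ENNReal.one_ne_top hmle
  have hminv : IsInvariantMass q m := by
    refine isInvariantMass_of_le hmfin fun y => ?_
    refine tsum_mul_le_of_tendsto hmlim (fun i => ?_) (Eventually.of_forall fun N => ?_)
      (by simpa using (hmlim y).add hinv)
    · exact ENNReal.ne_top_of_tsum_ne_top (by rw [tsum_unifStep]; exact ENNReal.one_ne_top) y
    -- Applying `K` to `S N` telescopes to an error of at most `1`, which vanishes after division by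
    -- `N`.
    · have e : ∑' x, S N x * unifStep q x y = ∑ n ∈ Finset.range N, unifSteps q (n + 1) o y := by
        simp only [hS, Finset.sum_mul]
        rw [Summable.tsum_finsetSum fun _ _ => ENNReal.summable]
        rfl
      have e' : ∑' x, S N x * unifStep q x y ≤ S N y + 1 := by
        rw [e]
        calc _ ≤ ∑ n ∈ Finset.range N, unifSteps q (n + 1) o y + unifSteps q 0 o y := le_self_add
          _ = ∑ n ∈ Finset.range N, unifSteps q n o y + unifSteps q N o y := by
            rw [← Finset.sum_range_succ' (fun n => unifSteps q n o y), Finset.sum_range_succ]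
          _ ≤ _ := add_le_add_right (unifSteps_le_one N o y) _
      calc ∑' x, S N x / N * unifStep q x y = (∑' x, S N x * unifStep q x y) / N := by
            simp only [div_eq_mul_inv, ← ENNReal.tsum_mul_right]
            exact tsum_congr fun x => by ring
        _ ≤ (S N y + 1) / N := ENNReal.div_le_div_right e' _
        _ = _ := by rw [ENNReal.add_div, one_div]
  have hεC : ε / C ≠ 0 := (ENNReal.div_pos hε hq.ne_top).ne'
  have hbC : b / C ≠ ⊤ := ENNReal.div_ne_top hb hq.ne_zero
  -- The summed drift inequality forces a positive fraction of time in `F`; as `F` is finite, this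
  -- mass survives in the limit and `m` is nonzero.
  have hF : ε / C ≤ (b / C) * ∑ y ∈ F, m y := by
    have l1 : Tendsto (fun N : ℕ => V o * (N : ℝ≥0∞)⁻¹ + (b / C) * ∑ y ∈ F, S N y / N) U
        (𝓝 (V o * 0 + (b / C) * ∑ y ∈ F, m y)) :=
      (ENNReal.Tendsto.const_mul hinv (Or.inr (hV o))).add
        (ENNReal.Tendsto.const_mul (tendsto_finsetSum _ fun y _ => hmlim y) (Or.inr hbC))
    rw [mul_zero, zero_add] at l1
    refine ge_of_tendsto l1 ?_
    filter_upwards [hN] with N hN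
    have h1 := (le_add_self).trans (hiter N)
    have h2 := mul_le_mul_left h1 (N : ℝ≥0∞)⁻¹
    calc ε / C = N * (ε / C) * (N : ℝ≥0∞)⁻¹ := by
          rw [mul_right_comm, ENNReal.mul_inv_cancel (by exact_mod_cast hN) (by simp), one_mul]
      _ ≤ _ := h2
      _ = _ := by
        rw [add_mul, mul_assoc, Finset.sum_mul]
        simp only [div_eq_mul_inv]
  have hm0 : ∑' y, m y ≠ 0 := by
    intro h0
    rw [ENNReal.tsum_eq_zero] at h0
    simp only [h0, Finset.sum_const_zero, mul_zero, nonpos_iff_eq_zero] at hF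
    exact hεC hF
  refine ⟨PMF.normalize m hm0 hmfin, fun y => ?_⟩
  simp only [PMF.normalize_apply]
  rw [← hminv y, ← ENNReal.tsum_mul_right]
  exact tsum_congr fun x => by ring

/-! ### Consequences for the continuous-time chain -/

theorem isErgodicChain_transProb (hq : RegularRates q) (hirr : IsIrreducibleUnif q)
    {π : PMF E} (h : IsInvariantMass q π) : IsErgodicChain (transProb q) :=
  ⟨isIrreducibleChain_transProb hq hirr, π, tendsto_transProb hq hirr h⟩

/-- A stationary `π'` is the `π'`-average of `P_t(·, y)`, which tends to `π y` by dominated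
convergence. -/
theorem isStable_transProb (hq : RegularRates q) (hirr : IsIrreducibleUnif q)
    {π : PMF E} (h : IsInvariantMass q π) : IsStable (transProb q) := by
  refine ⟨π, fun t y => h.transProb t y, fun π' h' => PMF.ext fun y => ?_⟩
  have hlim := tendsto_tsum_mul (w := π') (l := (atTop : Filter ℝ≥0)) (by simp)
    (fun t w => transProb_le_one t w y) (fun x => tendsto_transProb hq hirr h x y)
  simp only [h' _ y, ENNReal.tsum_mul_right, π'.tsum_coe, one_mul] at hlim
  exact tendsto_nhds_unique tendsto_const_nhds hlim

theorem IsErgodicChain.exists_isInvariantMass [Nonempty E] (hq : RegularRates q)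
    (h : IsErgodicChain (transProb q)) : ∃ π : PMF E, IsInvariantMass q π := by
  obtain ⟨-, π, hπ⟩ := h
  exact ⟨π, isInvariantMass_of_tendsto hq (hπ (Classical.arbitrary E))⟩

/-- Under an invariant distribution a bounded function has zero mean drift. -/
theorem IsInvariantMass.flux (hq : RegularRates q) {π : PMF E} (h : IsInvariantMass q π)
    {f u v : E → ℝ≥0∞} {M : ℝ≥0∞} (hM : M ≠ ⊤) (hf : ∀ x, f x ≤ M)
    (huv : ∀ x, ∑' y, q x y * f y + u x = exitRate q x * f x + v x) :
    ∑' x, π x * u x = ∑' x, π x * v x := by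
  set C := maxRate q
  -- The drift of `f` is `v - u`, stated without subtraction. Boundedness of `f` makes the terms to
  -- be cancelled finite.
  have hbal : ∑' x, π x * ∑' y, q x y * f y = ∑' x, π x * (exitRate q x * f x) := by
    have hs : ∑' x, π x * ∑' y, unifStep q x y * f y = ∑' y, π y * f y := by
      simp only [← ENNReal.tsum_mul_left]
      rw [ENNReal.tsum_comm]
      refine tsum_congr fun y => ?_
      rw [← h y, ← ENNReal.tsum_mul_right]
      exact tsum_congr fun w => by ring
    have hsplit : ∀ x, f x = exitRate q x * f x / C + (1 - exitRate q x / C) * f x := by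
      intro x
      have : exitRate q x * f x / C = exitRate q x / C * f x := by
        simp only [div_eq_mul_inv]; ring
      rw [this, ← add_mul, add_tsub_cancel_of_le (exitRate_div_maxRate_le_one q x), one_mul]
    have hs2 : ∑' y, π y * f y = ∑' x, π x * (exitRate q x * f x / C) +
        ∑' x, π x * ((1 - exitRate q x / C) * f x) := by
      rw [← ENNReal.tsum_add]
      refine tsum_congr fun x => ?_
      rw [← mul_add, ← hsplit x]
    simp only [tsum_unifStep_mul, mul_add, ENNReal.tsum_add] at hs
    rw [hs2] at hs
    have hfin : ∑' x, π x * ((1 - exitRate q x / C) * f x) ≠ ⊤ := by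
      refine ne_top_of_le_ne_top (b := ∑' x, π x * M) ?_ (ENNReal.tsum_le_tsum fun x => ?_)
      · rw [ENNReal.tsum_mul_right, π.tsum_coe, one_mul]; exact hM
      · gcongr
        exact (mul_le_of_le_one_left zero_le tsub_le_self).trans (hf x)
    have h1 := (ENNReal.add_left_inj hfin).1 hs
    simp only [div_eq_mul_inv, ← mul_assoc, ENNReal.tsum_mul_right] at h1
    have hCinv0 : C⁻¹ ≠ 0 := ENNReal.inv_ne_zero.2 hq.ne_top
    have hCinvt : C⁻¹ ≠ ⊤ := ENNReal.inv_ne_top.2 hq.ne_zero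
    simpa only [mul_assoc] using (ENNReal.mul_left_inj hCinv0 hCinvt).1 h1
  have hfin : ∑' x, π x * (exitRate q x * f x) ≠ ⊤ := by
    refine ne_top_of_le_ne_top (b := ∑' x, π x * (C * M)) ?_ (ENNReal.tsum_le_tsum fun x => ?_)
    · rw [ENNReal.tsum_mul_right, π.tsum_coe, one_mul]; exact ENNReal.mul_ne_top hq.ne_top hM
    · gcongr
      · exact exitRate_le_maxRate q x
      · exact hf x
  have h2 : ∑' x, π x * (∑' y, q x y * f y + u x) = ∑' x, π x * (exitRate q x * f x + v x) :=
    tsum_congr fun x => by rw [huv x]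
  simp only [mul_add, ENNReal.tsum_add] at h2
  rw [hbal] at h2
  exact (ENNReal.add_right_inj hfin).1 h2

end Chain

/-! ### The necessary condition -/

section Necessary

variable {E : Type*} [DecidableEq E] {q : E → E → ℝ≥0∞}

/-- In equilibrium the arrival rate is the throughput of an unreliable server that is idle with
positive probability, hence is less than the capacity of that server. -/
theorem arrivalRate_lt_of_isInvariantMass (hq : RegularRates q) {π : PMF E}
    (h : IsInvariantMass q π) {lam mu α β : ℝ} (hmu : 0 < mu) (hα : 0 < α)
    (hβ : 0 < β) (s : E → Status) (N : E → ℕ) (busy : E → Prop) [DecidablePred busy]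
    (hstatus : ∀ x, ∑' y, q x y * (if s y = .down then 1 else 0) +
        (if s x = .down then ENNReal.ofReal β else 0) =
      exitRate q x * (if s x = .down then 1 else 0) + if s x = .up then ENNReal.ofReal α else 0)
    (hlevel : ∀ (K : ℕ) (x : E), ∑' y, q x y * ((min (N y) K : ℕ) : ℝ≥0∞) +
        (if s x = .up ∧ busy x ∧ N x ≤ K then ENNReal.ofReal mu else 0) =
      exitRate q x * ((min (N x) K : ℕ) : ℝ≥0∞) + if N x < K then ENNReal.ofReal lam else 0)
    {o : E} (hso : s o = .up) (hbo : ¬ busy o) (ho : π o ≠ 0) :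
    lam < β / (α + β) * mu := by
  set U := ∑' x, π x * (if s x = .up then 1 else 0) with hU
  set D := ∑' x, π x * (if s x = .down then 1 else 0) with hD
  set W := ∑' x, π x * (if s x = .up ∧ busy x then 1 else 0) with hW
  have hUD : U + D = 1 := by
    rw [hU, hD, ← ENNReal.tsum_add, ← π.tsum_coe]
    refine tsum_congr fun x => ?_
    cases s x <;> simp
  have hBA : ENNReal.ofReal β * D = ENNReal.ofReal α * U := by
    have := h.flux hq ENNReal.one_ne_top (fun x => by split_ifs <;> simp) hstatus
    rw [hU, hD, ← ENNReal.tsum_mul_left, ← ENNReal.tsum_mul_left]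
    convert this using 3 with x x
    · split_ifs <;> simp [mul_comm]
    · split_ifs <;> simp [mul_comm]
  have hWU : W + π o ≤ U := by
    have e : π o = ∑' x, if x = o then π x else 0 := by simp
    rw [hU, hW, e, ← ENNReal.tsum_add]
    refine ENNReal.tsum_le_tsum fun x => ?_
    by_cases hx : x = o
    · simp [hx, hso, hbo]
    · simp only [hx, if_false, add_zero]
      gcongr
      split_ifs with h1 h2
      exacts [le_rfl, absurd h1.1 h2, zero_le, le_rfl]
  have hLW : ENNReal.ofReal lam ≤ ENNReal.ofReal mu * W := by
    -- The number of customers is unbounded, so it is truncated at `K` to have zero mean drift.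
    have hK : ∀ K : ℕ, ∑' x, π x * (if N x < K then ENNReal.ofReal lam else 0) ≤
        ENNReal.ofReal mu * W := by
      intro K
      rw [← h.flux hq (ENNReal.natCast_ne_top K) (fun x => by exact_mod_cast min_le_right _ _)
        (hlevel K), hW, ← ENNReal.tsum_mul_left]
      refine ENNReal.tsum_le_tsum fun x => ?_
      rw [mul_left_comm]
      gcongr
      split_ifs <;> simp_all
    have hone : ENNReal.ofReal lam = ∑' x, π x * ENNReal.ofReal lam := by
      rw [ENNReal.tsum_mul_right, π.tsum_coe, one_mul]
    rw [hone, ENNReal.tsum_eq_iSup_sum]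
    -- On a finite set of states a truncation level above every `N x` is invisible.
    refine iSup_le fun t => le_trans ?_ (hK (t.sup N + 1))
    refine le_trans (Finset.sum_le_sum fun x hx => ?_) (ENNReal.sum_le_tsum t)
    rw [if_pos (Nat.lt_succ_of_le (Finset.le_sup hx))]
  have hUt : U ≠ ⊤ := ne_top_of_le_ne_top ENNReal.one_ne_top (hUD ▸ le_self_add)
  have hDt : D ≠ ⊤ := ne_top_of_le_ne_top ENNReal.one_ne_top (hUD ▸ le_add_self)
  have hWt : W ≠ ⊤ := ne_top_of_le_ne_top hUt (le_self_add.trans hWU)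
  have r1 : U.toReal + D.toReal = 1 := by
    rw [← ENNReal.toReal_add hUt hDt, hUD, ENNReal.toReal_one]
  have r2 : β * D.toReal = α * U.toReal := by
    simpa [ENNReal.toReal_mul, hα.le, hβ.le] using congrArg ENNReal.toReal hBA
  have r3 : W.toReal < U.toReal := by
    refine (ENNReal.toReal_lt_toReal hWt hUt).2 (lt_of_lt_of_le ?_ hWU)
    exact ENNReal.lt_add_right hWt ho
  have r4 : lam ≤ mu * W.toReal := by
    rw [← ENNReal.ofReal_toReal hWt, ← ENNReal.ofReal_mul hmu.le] at hLW
    exact (ENNReal.ofReal_le_ofReal_iff (by positivity)).1 hLW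
  have r5 : U.toReal = β / (α + β) := by
    rw [eq_div_iff (by positivity)]
    linear_combination β * r1 - r2
  rw [← r5]
  nlinarith

end Necessary

theorem natCast_min_succ (n K : ℕ) :
    ((min (n + 1) K : ℕ) : ℝ≥0∞) = ((min n K : ℕ) : ℝ≥0∞) + if n < K then 1 else 0 := by
  split_ifs with h
  · rw [min_eq_left h, min_eq_left h.le]; push_cast; rfl
  · rw [min_eq_right (by omega), min_eq_right (by omega), add_zero]

/-- The choice `c = mu / (α + β)` equalizes the drifts `r + α c - mu` (up and busy) and `r - β c`
(down); both are then `-2 ε`. One `ε` serves the drift criterion, the other is spare room for the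
correction term of the network. -/
theorem exists_drift_constants {r mu α β : ℝ} (hmu : 0 < mu) (hα : 0 < α) (hβ : 0 < β)
    (h : r < β / (α + β) * mu) :
    ∃ c ε, 0 < c ∧ 0 < ε ∧ r + 2 * ε ≤ β * c ∧ r + α * c + 2 * ε ≤ mu := by
  refine ⟨mu / (α + β), (β / (α + β) * mu - r) / 2, by positivity, by linarith, ?_, ?_⟩
  · apply le_of_eq; field_simp; ring
  · apply le_of_eq; field_simp; ring

instance : Nonempty Status := ⟨.up⟩

/-! ### The unreliable `M/M/1` queue -/

section Model1

variable {lam mu α β : ℝ}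

/-- The truncated `x - 1` at `x = 0` is harmless, since its coefficient vanishes there. -/
theorem tsum_model1Rate_up (x : ℕ) (f : ℕ × Status → ℝ≥0∞) :
    ∑' z, model1Rate lam mu α β (x, .up) z * f z =
      ENNReal.ofReal lam * f (x + 1, .up) +
      (if x = 0 then 0 else ENNReal.ofReal mu) * f (x - 1, .up) +
      ENNReal.ofReal α * f (x, .down) := by
  have e : ∀ z, model1Rate lam mu α β (x, .up) z =
      (if z = (x + 1, .up) then ENNReal.ofReal lam else 0) +
      (if z = (x - 1, .up) then (if x = 0 then 0 else ENNReal.ofReal mu) else 0) +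
      (if z = (x, .down) then ENNReal.ofReal α else 0) := by
    rintro ⟨x', _ | _⟩
    · rcases x with _ | x <;> simp [model1Rate]
    · simp [model1Rate]
  simp only [e, add_mul, ENNReal.tsum_add, ite_mul, zero_mul, tsum_ite_eq]

theorem tsum_model1Rate_down (x : ℕ) (f : ℕ × Status → ℝ≥0∞) :
    ∑' z, model1Rate lam mu α β (x, .down) z * f z =
      ENNReal.ofReal lam * f (x + 1, .down) + ENNReal.ofReal β * f (x, .up) := by
  have e : ∀ z, model1Rate lam mu α β (x, .down) z =
      (if z = (x + 1, .down) then ENNReal.ofReal lam else 0) +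
      (if z = (x, .up) then ENNReal.ofReal β else 0) := by
    rintro ⟨x', _ | _⟩ <;> simp [model1Rate]
  simp only [e, add_mul, ENNReal.tsum_add, ite_mul, zero_mul, tsum_ite_eq]

theorem exitRate_model1Rate_up (x : ℕ) :
    exitRate (model1Rate lam mu α β) (x, .up) =
      ENNReal.ofReal lam + (if x = 0 then 0 else ENNReal.ofReal mu) + ENNReal.ofReal α := by
  simpa [exitRate] using tsum_model1Rate_up (lam := lam) (mu := mu) (α := α) (β := β) x 1

theorem exitRate_model1Rate_down (x : ℕ) :
    exitRate (model1Rate lam mu α β) (x, .down) = ENNReal.ofReal lam + ENNReal.ofReal β := by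
  simpa [exitRate] using tsum_model1Rate_down (lam := lam) (mu := mu) (α := α) (β := β) x 1

theorem regularRates_model1Rate (hlam : 0 < lam) : RegularRates (model1Rate lam mu α β) where
  ne_zero := by
    refine ne_of_gt (lt_of_lt_of_le ?_ (exitRate_le_maxRate _ (0, .down)))
    rw [exitRate_model1Rate_down]
    exact lt_of_lt_of_le (ENNReal.ofReal_pos.2 hlam) le_self_add
  ne_top := by
    refine ne_top_of_le_ne_top (b := ENNReal.ofReal lam + ENNReal.ofReal mu + ENNReal.ofReal α +
      ENNReal.ofReal β) (by simp) (iSup_le ?_)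
    rintro ⟨x, _ | _⟩
    · rw [exitRate_model1Rate_up]
      refine le_trans ?_ le_self_add
      gcongr
      split_ifs <;> simp
    · rw [exitRate_model1Rate_down, add_assoc, add_assoc]
      gcongr
      exact le_add_self.trans le_add_self

theorem isIrreducibleUnif_model1Rate (hlam : 0 < lam) (hmu : 0 < mu) (hα : 0 < α) (hβ : 0 < β) :
    IsIrreducibleUnif (model1Rate lam mu α β) := by
  have hto : ∀ x, Relation.ReflTransGen (fun a b => model1Rate lam mu α β a b ≠ 0)
      (x, Status.up) (0, Status.up) := by
    intro x
    induction x with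
    | zero => exact .refl
    | succ x ih => exact .head (by simp [model1Rate, hmu]) ih
  have hfrom : ∀ x, Relation.ReflTransGen (fun a b => model1Rate lam mu α β a b ≠ 0)
      (0, Status.up) (x, Status.up) := by
    intro x
    induction x with
    | zero => exact .refl
    | succ x ih => exact .tail ih (by simp [model1Rate, hlam])
  refine isIrreducibleUnif_of_reachable (regularRates_model1Rate hlam) (0, .up) ?_ ?_
  · rintro ⟨x, _ | _⟩
    · exact hto x
    · exact .head (by simp [model1Rate, hβ]) (hto x)
  · rintro ⟨x, _ | _⟩
    · exact hfrom x
    · exact .tail (hfrom x) (by simp [model1Rate, hα])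

theorem exists_isInvariantMass_model1Rate (hlam : 0 < lam) (hmu : 0 < mu) (hα : 0 < α)
    (hβ : 0 < β) (h : lam < β / (α + β) * mu) :
    ∃ π : PMF (ℕ × Status), IsInvariantMass (model1Rate lam mu α β) π := by
  obtain ⟨c, ε, hc, hε, h1, h2⟩ := exists_drift_constants hmu hα hβ h
  -- A pending repair counts as `c` customers. The drift fails to be negative enough only possibly
  -- at the empty up state, where no service takes place.
  refine exists_isInvariantMass_of_drift (regularRates_model1Rate hlam)
    (V := fun z => ENNReal.ofReal ((z.1 : ℝ) + if z.2 = .down then c else 0)) (by simp)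
    {(0, .up)} (ε := ENNReal.ofReal ε) (b := ENNReal.ofReal (lam + α * c + ε)) (by simpa)
    (by simp) ?_
  rintro ⟨x, _ | _⟩
  · rw [tsum_model1Rate_up, exitRate_model1Rate_up]
    rcases x with _ | x
    · simp only [Finset.mem_singleton, if_true, zero_mul, add_zero, reduceCtorEq, if_false]
      rw [← ENNReal.ofReal_mul hlam.le, ← ENNReal.ofReal_mul hα.le,
        ← ENNReal.ofReal_add (by positivity) (by positivity),
        ← ENNReal.ofReal_add (by positivity) (by positivity)]
      refine le_add_left (ENNReal.ofReal_le_ofReal ?_)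
      push_cast
      linarith
    · simp only [Finset.mem_singleton, if_true, add_zero, reduceCtorEq, if_false,
        Nat.add_eq_zero_iff, one_ne_zero, and_false, Prod.mk.injEq, false_and,
        Nat.add_sub_cancel]
      rw [← ENNReal.ofReal_mul hlam.le, ← ENNReal.ofReal_mul hα.le, ← ENNReal.ofReal_mul hmu.le,
        ← ENNReal.ofReal_add (by positivity) (by positivity),
        ← ENNReal.ofReal_add (by positivity) (by positivity),
        ← ENNReal.ofReal_add (by positivity) (by positivity),
        ← ENNReal.ofReal_add (by positivity) (by positivity),
        ← ENNReal.ofReal_add (by positivity) (by positivity),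
        ← ENNReal.ofReal_mul (by positivity)]
      refine ENNReal.ofReal_le_ofReal ?_
      push_cast
      linear_combination h2 + hε
  · rw [tsum_model1Rate_down, exitRate_model1Rate_down]
    simp only [Finset.mem_singleton, if_true, add_zero, reduceCtorEq, if_false, Prod.mk.injEq,
      and_false]
    rw [← ENNReal.ofReal_mul hlam.le, ← ENNReal.ofReal_mul hβ.le,
      ← ENNReal.ofReal_add (by positivity) (by positivity),
      ← ENNReal.ofReal_add (by positivity) (by positivity),
      ← ENNReal.ofReal_add (by positivity) (by positivity),
      ← ENNReal.ofReal_mul (by positivity)]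
    refine ENNReal.ofReal_le_ofReal ?_
    push_cast
    linear_combination h1 + hε

theorem lt_of_isInvariantMass_model1Rate (hlam : 0 < lam) (hmu : 0 < mu) (hα : 0 < α)
    (hβ : 0 < β) {π : PMF (ℕ × Status)} (h : IsInvariantMass (model1Rate lam mu α β) π) :
    lam < β / (α + β) * mu := by
  refine arrivalRate_lt_of_isInvariantMass (regularRates_model1Rate hlam) h hmu hα hβ
    Prod.snd Prod.fst (fun z => z.1 ≠ 0) ?_ ?_ (o := (0, .up)) rfl (by simp)
    (h.pos (isIrreducibleUnif_model1Rate hlam hmu hα hβ) _)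
  · rintro ⟨x, _ | _⟩
    · rw [tsum_model1Rate_up, exitRate_model1Rate_up]
      simp
    · rw [tsum_model1Rate_down, exitRate_model1Rate_down]
      simp
  · rintro K ⟨x, _ | _⟩
    · rw [tsum_model1Rate_up, exitRate_model1Rate_up]
      rcases x with _ | x
      · simp only [natCast_min_succ]
        simp
      · simp only [natCast_min_succ, Nat.add_sub_cancel, Nat.succ_le_iff]
        simp only [Nat.add_eq_zero_iff, one_ne_zero, and_false, if_false, ne_eq, not_false_eq_true,
          true_and]
        split_ifs <;> ring
    · rw [tsum_model1Rate_down, exitRate_model1Rate_down]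
      simp only [natCast_min_succ, reduceCtorEq, false_and, if_false]
      split_ifs <;> ring

end Model1

/-! ### The two-server network -/

section Model2

variable {lam mu α β p : ℝ}

theorem tsum_model2Rate_up (x y : ℕ) (f : ℕ × ℕ × Status → ℝ≥0∞) :
    ∑' z, model2Rate lam mu α β p (x, y, .up) z * f z =
      ENNReal.ofReal lam * f (x, y + 1, .up) +
      (if y = 0 then 0 else ENNReal.ofReal mu) * f (x + 1, y - 1, .up) +
      (if x = 0 then 0 else ENNReal.ofReal (mu * p)) * f (x - 1, y, .up) +
      (if x = 0 then 0 else ENNReal.ofReal (mu * (1 - p))) * f (x - 1, y + 1, .up) +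
      ENNReal.ofReal α * f (x, y, .down) := by
  have e : ∀ z, model2Rate lam mu α β p (x, y, .up) z =
      (if z = (x, y + 1, .up) then ENNReal.ofReal lam else 0) +
      (if z = (x + 1, y - 1, .up) then (if y = 0 then 0 else ENNReal.ofReal mu) else 0) +
      (if z = (x - 1, y, .up) then (if x = 0 then 0 else ENNReal.ofReal (mu * p)) else 0) +
      (if z = (x - 1, y + 1, .up) then
        (if x = 0 then 0 else ENNReal.ofReal (mu * (1 - p))) else 0) +
      (if z = (x, y, .down) then ENNReal.ofReal α else 0) := by
    rintro ⟨x', y', _ | _⟩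
    · rcases x with _ | x <;> rcases y with _ | y <;> simp [model2Rate]
    · simp [model2Rate]
  simp only [e, add_mul, ENNReal.tsum_add, ite_mul, zero_mul, tsum_ite_eq]

theorem tsum_model2Rate_down (x y : ℕ) (f : ℕ × ℕ × Status → ℝ≥0∞) :
    ∑' z, model2Rate lam mu α β p (x, y, .down) z * f z =
      ENNReal.ofReal lam * f (x, y + 1, .down) +
      (if y = 0 then 0 else ENNReal.ofReal mu) * f (x + 1, y - 1, .down) +
      ENNReal.ofReal β * f (x, y, .up) := by
  have e : ∀ z, model2Rate lam mu α β p (x, y, .down) z =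
      (if z = (x, y + 1, .down) then ENNReal.ofReal lam else 0) +
      (if z = (x + 1, y - 1, .down) then (if y = 0 then 0 else ENNReal.ofReal mu) else 0) +
      (if z = (x, y, .up) then ENNReal.ofReal β else 0) := by
    rintro ⟨x', y', _ | _⟩
    · simp [model2Rate]
    · rcases y with _ | y <;> simp [model2Rate]
  simp only [e, add_mul, ENNReal.tsum_add, ite_mul, zero_mul, tsum_ite_eq]

theorem exitRate_model2Rate_up (x y : ℕ) :
    exitRate (model2Rate lam mu α β p) (x, y, .up) =
      ENNReal.ofReal lam + (if y = 0 then 0 else ENNReal.ofReal mu) +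
      (if x = 0 then 0 else ENNReal.ofReal (mu * p)) +
      (if x = 0 then 0 else ENNReal.ofReal (mu * (1 - p))) + ENNReal.ofReal α := by
  simpa [exitRate] using
    tsum_model2Rate_up (lam := lam) (mu := mu) (α := α) (β := β) (p := p) x y 1

theorem exitRate_model2Rate_down (x y : ℕ) :
    exitRate (model2Rate lam mu α β p) (x, y, .down) =
      ENNReal.ofReal lam + (if y = 0 then 0 else ENNReal.ofReal mu) + ENNReal.ofReal β := by
  simpa [exitRate] using
    tsum_model2Rate_down (lam := lam) (mu := mu) (α := α) (β := β) (p := p) x y 1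

theorem regularRates_model2Rate (hlam : 0 < lam) : RegularRates (model2Rate lam mu α β p) where
  ne_zero := by
    refine ne_of_gt (lt_of_lt_of_le ?_ (exitRate_le_maxRate _ (0, 0, .down)))
    rw [exitRate_model2Rate_down, add_assoc]
    exact lt_of_lt_of_le (ENNReal.ofReal_pos.2 hlam) le_self_add
  ne_top := by
    refine ne_top_of_le_ne_top (b := ENNReal.ofReal lam + ENNReal.ofReal mu +
      ENNReal.ofReal (mu * p) + ENNReal.ofReal (mu * (1 - p)) + (ENNReal.ofReal α +
      ENNReal.ofReal β)) (by simp) (iSup_le ?_)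
    rintro ⟨x, y, _ | _⟩
    · rw [exitRate_model2Rate_up]
      gcongr
      · split_ifs <;> simp
      · split_ifs <;> simp
      · split_ifs <;> simp
      · exact le_self_add
    · rw [exitRate_model2Rate_down]
      refine add_le_add (le_trans ?_ (le_self_add.trans le_self_add)) le_add_self
      gcongr
      split_ifs <;> simp

/-- With server 1 up, all customers can pass to server 1 and then leave. Conversely, `(x, y)` is
reached by letting `x + y` customers arrive and moving `x` of them on. -/
theorem isIrreducibleUnif_model2Rate (hlam : 0 < lam) (hmu : 0 < mu) (hα : 0 < α) (hβ : 0 < β)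
    (hp : 0 < p) : IsIrreducibleUnif (model2Rate lam mu α β p) := by
  have hmp : 0 < mu * p := mul_pos hmu hp
  have hto0 : ∀ x, Relation.ReflTransGen (fun a b => model2Rate lam mu α β p a b ≠ 0)
      (x, 0, Status.up) (0, 0, Status.up) := by
    intro x
    induction x with
    | zero => exact .refl
    | succ x ih => exact .head (by simp [model2Rate, hmp]) ih
  have hto : ∀ y x, Relation.ReflTransGen (fun a b => model2Rate lam mu α β p a b ≠ 0)
      (x, y, Status.up) (0, 0, Status.up) := by
    intro y
    induction y with
    | zero => exact hto0
    | succ y ih => exact fun x => .head (by simp [model2Rate, hmu]) (ih (x + 1))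
  have hfrom0 : ∀ y, Relation.ReflTransGen (fun a b => model2Rate lam mu α β p a b ≠ 0)
      (0, 0, Status.up) (0, y, Status.up) := by
    intro y
    induction y with
    | zero => exact .refl
    | succ y ih => exact .tail ih (by simp [model2Rate, hlam])
  have hfrom : ∀ x y, Relation.ReflTransGen (fun a b => model2Rate lam mu α β p a b ≠ 0)
      (0, 0, Status.up) (x, y, Status.up) := by
    intro x
    induction x with
    | zero => exact hfrom0
    | succ x ih => exact fun y => .tail (ih (y + 1)) (by simp [model2Rate, hmu])
  refine isIrreducibleUnif_of_reachable (regularRates_model2Rate hlam) (0, 0, .up) ?_ ?_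
  · rintro ⟨x, y, _ | _⟩
    · exact hto y x
    · exact .head (by simp [model2Rate, hβ]) (hto y x)
  · rintro ⟨x, y, _ | _⟩
    · exact hfrom x y
    · exact .tail (hfrom x y) (by simp [model2Rate, hα])

/-- Transfers between servers leave `x + y` unchanged, and for `p = 1` every service at server 1 is
a departure, so `x + y` obeys the balance of a single unreliable server that is busy when `x ≠ 0`.
-/
theorem lt_of_isInvariantMass_model2Rate (hlam : 0 < lam) (hmu : 0 < mu) (hα : 0 < α)
    (hβ : 0 < β) {π : PMF (ℕ × ℕ × Status)}
    (h : IsInvariantMass (model2Rate lam mu α β 1) π) : lam < β / (α + β) * mu := by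
  refine arrivalRate_lt_of_isInvariantMass (regularRates_model2Rate hlam) h hmu hα hβ
    (fun z => z.2.2) (fun z => z.1 + z.2.1) (fun z => z.1 ≠ 0) ?_ ?_ (o := (0, 0, .up)) rfl
    (by simp) (h.pos (isIrreducibleUnif_model2Rate hlam hmu hα hβ one_pos) _)
  · rintro ⟨x, y, _ | _⟩
    · rw [tsum_model2Rate_up, exitRate_model2Rate_up]
      simp
    · rw [tsum_model2Rate_down, exitRate_model2Rate_down]
      simp
  · rintro K ⟨x, y, _ | _⟩
    · rw [tsum_model2Rate_up, exitRate_model2Rate_up]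
      rcases x with _ | x <;> rcases y with _ | y <;>
        simp only [← add_assoc, add_right_comm _ 1 _, natCast_min_succ, Nat.add_sub_cancel,
          Nat.succ_le_iff, sub_self, mul_zero, mul_one, ENNReal.ofReal_zero, ite_self, zero_mul,
          Nat.add_eq_zero_iff, one_ne_zero, and_false, if_false, ne_eq, not_false_eq_true,
          true_and, if_true, not_true_eq_false, false_and, add_zero] <;>
        split_ifs <;> ring
    · rw [tsum_model2Rate_down, exitRate_model2Rate_down]
      rcases y with _ | y <;>
        simp only [← add_assoc, add_right_comm _ 1 _, natCast_min_succ, Nat.add_sub_cancel,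
          Nat.add_eq_zero_iff, one_ne_zero, and_false, if_false, if_true, zero_mul,
          reduceCtorEq, false_and, add_zero] <;>
        split_ifs <;> ring

/-- The Lyapunov function is the workload `(x + y) / p` of server 1, plus a constant `c` for the
pending repair, plus a term `A * θ ^ x` that decreases fast enough near `x = 0` to make up for the
idleness of server 1. -/
theorem exists_isInvariantMass_model2Rate (hlam : 0 < lam) (hmu : 0 < mu) (hα : 0 < α)
    (hβ : 0 < β) (hp : 0 < p) (hp1 : p ≤ 1) (h : lam < β / (α + β) * mu * p) :
    ∃ π : PMF (ℕ × ℕ × Status), IsInvariantMass (model2Rate lam mu α β p) π := by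
  obtain ⟨w, hw, hpw⟩ : ∃ w, 0 < w ∧ p * w = 1 := ⟨1 / p, by positivity, by field_simp⟩
  have h' : lam * w < β / (α + β) * mu := by
    calc lam * w < β / (α + β) * mu * p * w := mul_lt_mul_of_pos_right h hw
      _ = _ := by rw [mul_assoc, hpw, mul_one]
  obtain ⟨c, ε, hc, hε, h1, h2⟩ := exists_drift_constants hmu hα hβ h'
  -- At `x = 0`, up, the linear part has drift `lam * w + α * c`; an extra decrease `R` turns it
  -- into `-ε`.
  obtain ⟨R, hR⟩ : ∃ R, R = lam * w + α * c + ε := ⟨_, rfl⟩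
  have hR0 : 0 < R := by rw [hR]; positivity
  obtain ⟨δ, hδ0, hδ1, hRδ⟩ : ∃ δ, 0 < δ ∧ δ < 1 ∧ R * δ ≤ ε := by
    refine ⟨ε / R, by positivity, ?_, by rw [mul_div_cancel₀ _ hR0.ne']⟩
    rw [div_lt_one hR0, hR]
    have : 0 < lam * w + α * c := by positivity
    linarith
  -- With `θ = 1 - δ`, the term `A θ ^ x` gets drift `-R θ ^ x` from server 2 and `+R θ ^ (x - 1)`
  -- from server 1. When both work the sum is `R δ θ ^ (x - 1) ≤ ε`.
  obtain ⟨A, hA0, hA⟩ : ∃ A, 0 < A ∧ mu * A * δ = R :=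
    ⟨R / (mu * δ), by positivity, by field_simp⟩
  obtain ⟨θ, hθ⟩ : ∃ θ, θ = 1 - δ := ⟨_, rfl⟩
  have hθ0 : 0 < θ := by linarith
  have hθ1 : θ < 1 := by linarith
  -- For `y = 0` the increase `R θ ^ (x - 1)` is not compensated; it is below `ε` once `x > n`,
  -- which leaves a finite exceptional set.
  obtain ⟨n, hn⟩ : ∃ n : ℕ, θ ^ n < ε / R := exists_pow_lt_of_lt_one (by positivity) hθ1
  have ht0 : ∀ x : ℕ, 0 < θ ^ x := fun x => pow_pos hθ0 x
  have ht1 : ∀ x : ℕ, θ ^ x ≤ 1 := fun x => pow_le_one₀ hθ0.le hθ1.le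
  have hq1 : 0 ≤ mu * (1 - p) := mul_nonneg hmu.le (by linarith)
  have hmp : 0 < mu * p := mul_pos hmu hp
  refine exists_isInvariantMass_of_drift (regularRates_model2Rate hlam)
    (V := fun z => ENNReal.ofReal (((z.1 : ℝ) + z.2.1) * w + A * θ ^ z.1 +
      if z.2.2 = .down then c else 0)) (by simp)
    ((Finset.range (n + 1)).image fun x => (x, 0, Status.up))
    (ε := ENNReal.ofReal ε) (b := ENNReal.ofReal (lam * w + α * c + ε + R)) (by simpa)
    (by simp) ?_
  rintro ⟨x, y, _ | _⟩
  · rw [tsum_model2Rate_up, exitRate_model2Rate_up]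
    have hmem : ((x, y, Status.up) ∈ (Finset.range (n + 1)).image fun x => (x, 0, Status.up)) ↔
        x ≤ n ∧ y = 0 := by
      simp [eq_comm]
    simp only [hmem, if_true, add_zero, reduceCtorEq, if_false]
    rcases x with _ | x <;> rcases y with _ | y
    · simp only [if_true, zero_mul, add_zero, Nat.zero_le, and_self]
      rw [← ENNReal.ofReal_mul hlam.le, ← ENNReal.ofReal_mul hα.le,
        ← ENNReal.ofReal_add (by positivity) (by positivity),
        ← ENNReal.ofReal_add (by positivity) (by positivity),
        ← ENNReal.ofReal_add (by positivity) (by positivity),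
        ← ENNReal.ofReal_mul (by positivity), ← ENNReal.ofReal_add (by positivity) (by positivity)]
      refine ENNReal.ofReal_le_ofReal ?_
      push_cast
      linear_combination hR0
    · simp only [if_true, zero_mul, add_zero, Nat.add_eq_zero_iff, one_ne_zero, and_false, if_false,
        Nat.add_sub_cancel]
      rw [← ENNReal.ofReal_mul hlam.le, ← ENNReal.ofReal_mul hα.le, ← ENNReal.ofReal_mul hmu.le,
        ← ENNReal.ofReal_add (by positivity) (by positivity),
        ← ENNReal.ofReal_add (by positivity) (by positivity),
        ← ENNReal.ofReal_add (by positivity) (by positivity),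
        ← ENNReal.ofReal_add (by positivity) (by positivity),
        ← ENNReal.ofReal_add (by positivity) (by positivity),
        ← ENNReal.ofReal_mul (by positivity)]
      refine ENNReal.ofReal_le_ofReal ?_
      push_cast
      rw [hθ]
      linear_combination -hR - hA
    · simp only [if_true, zero_mul, add_zero, Nat.add_eq_zero_iff, one_ne_zero, and_false, if_false,
        Nat.add_sub_cancel, and_true]
      have hdrift : ENNReal.ofReal
          (lam * (((x + 1 : ℕ) + (0 + 1 : ℕ)) * w + A * θ ^ (x + 1)) +
          mu * p * ((x + (0 : ℕ)) * w + A * θ ^ x) +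
          mu * (1 - p) * ((x + (0 + 1 : ℕ)) * w + A * θ ^ x) +
          α * (((x + 1 : ℕ) + (0 : ℕ)) * w + A * θ ^ (x + 1) + c) + ε) ≤
          ENNReal.ofReal ((lam + mu * p + mu * (1 - p) + α) *
            (((x + 1 : ℕ) + (0 : ℕ)) * w + A * θ ^ (x + 1)) +
            if x + 1 ≤ n then lam * w + α * c + ε + R else 0) := by
        refine ENNReal.ofReal_le_ofReal ?_
        push_cast
        rw [pow_succ θ x]
        generalize htx : θ ^ x = t
        have ht1' : R * t ≤ R := by nlinarith [ht1 x]
        split_ifs with hx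
        · rw [hθ]
          linear_combination mu * hpw * (-1) + hmu + ht1' + t * hA
        · have ht2 : R * t ≤ ε := by
            have : θ ^ x ≤ θ ^ n := pow_le_pow_of_le_one hθ0.le hθ1.le (by omega)
            rw [htx] at this
            have := (this.trans_lt hn).le
            rw [le_div_iff₀ hR0] at this
            linarith
          rw [hθ]
          linear_combination mu * hpw * (-1) + h2 + ht2 + t * hA
      have hite : (if x + 1 ≤ n then ENNReal.ofReal (lam * w + α * c + ε + R) else 0) =
          ENNReal.ofReal (if x + 1 ≤ n then lam * w + α * c + ε + R else 0) := by
        split_ifs <;> simp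
      rw [hite]
      rw [← ENNReal.ofReal_mul hlam.le, ← ENNReal.ofReal_mul hα.le, ← ENNReal.ofReal_mul hmp.le,
        ← ENNReal.ofReal_mul hq1,
        ← ENNReal.ofReal_add (by positivity) (by positivity),
        ← ENNReal.ofReal_add (by positivity) (by positivity),
        ← ENNReal.ofReal_add (by positivity) (by positivity),
        ← ENNReal.ofReal_add (by positivity) (by positivity),
        ← ENNReal.ofReal_add (by positivity) (by positivity),
        ← ENNReal.ofReal_add (by positivity) (by positivity),
        ← ENNReal.ofReal_add (by positivity) (by positivity),
        ← ENNReal.ofReal_mul (by positivity),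
        ← ENNReal.ofReal_add (by positivity) (by split_ifs <;> positivity)]
      exact hdrift
    · simp only [Nat.add_eq_zero_iff, one_ne_zero, and_false, if_false, Nat.add_sub_cancel,
        add_zero]
      rw [← ENNReal.ofReal_mul hlam.le, ← ENNReal.ofReal_mul hα.le, ← ENNReal.ofReal_mul hmp.le,
        ← ENNReal.ofReal_mul hq1, ← ENNReal.ofReal_mul hmu.le,
        ← ENNReal.ofReal_add (by positivity) (by positivity),
        ← ENNReal.ofReal_add (by positivity) (by positivity),
        ← ENNReal.ofReal_add (by positivity) (by positivity),
        ← ENNReal.ofReal_add (by positivity) (by positivity),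
        ← ENNReal.ofReal_add (by positivity) (by positivity),
        ← ENNReal.ofReal_add (by positivity) (by positivity),
        ← ENNReal.ofReal_add (by positivity) (by positivity),
        ← ENNReal.ofReal_add (by positivity) (by positivity),
        ← ENNReal.ofReal_add (by positivity) (by positivity),
        ← ENNReal.ofReal_mul (by positivity)]
      refine ENNReal.ofReal_le_ofReal ?_
      push_cast
      rw [pow_succ θ (x + 1), pow_succ θ x]
      have ht : R * δ * θ ^ x ≤ ε :=
        (mul_le_of_le_one_right (by positivity) (ht1 x)).trans hRδ
      generalize θ ^ x = t at ht
      rw [hθ]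
      linear_combination mu * hpw * (-1) + h2 + ht + δ * t * hA
  · rw [tsum_model2Rate_down, exitRate_model2Rate_down]
    have hmem : ((x, y, Status.down) ∈
        (Finset.range (n + 1)).image fun x => (x, 0, Status.up)) ↔ False := by
      simp
    simp only [hmem, if_true, add_zero, reduceCtorEq, if_false]
    rcases y with _ | y
    · simp only [if_true, zero_mul, add_zero]
      rw [← ENNReal.ofReal_mul hlam.le, ← ENNReal.ofReal_mul hβ.le,
        ← ENNReal.ofReal_add (by positivity) (by positivity),
        ← ENNReal.ofReal_add (by positivity) (by positivity),
        ← ENNReal.ofReal_add (by positivity) (by positivity),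
        ← ENNReal.ofReal_mul (by positivity)]
      refine ENNReal.ofReal_le_ofReal ?_
      push_cast
      linear_combination h1 + hε
    · simp only [Nat.add_eq_zero_iff, one_ne_zero, and_false, if_false, Nat.add_sub_cancel]
      rw [← ENNReal.ofReal_mul hlam.le, ← ENNReal.ofReal_mul hβ.le, ← ENNReal.ofReal_mul hmu.le,
        ← ENNReal.ofReal_add (by positivity) (by positivity),
        ← ENNReal.ofReal_add (by positivity) (by positivity),
        ← ENNReal.ofReal_add (by positivity) (by positivity),
        ← ENNReal.ofReal_add (by positivity) (by positivity),
        ← ENNReal.ofReal_add (by positivity) (by positivity),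
        ← ENNReal.ofReal_mul (by positivity)]
      refine ENNReal.ofReal_le_ofReal ?_
      push_cast
      rw [pow_succ θ x]
      -- While server 1 is down, `x` can only grow, so the geometric term only helps.
      have ht : 0 ≤ R * θ ^ x := mul_nonneg hR0.le (ht0 x).le
      generalize θ ^ x = t at ht
      rw [hθ]
      linear_combination h1 + hε + ht - t * hA

end Model2

theorem lemma1 (lam mu α β : ℝ) (hlam : 0 < lam) (hmu : 0 < mu) (hα : 0 < α) (hβ : 0 < β) :
    (IsErgodicChain (transProb (model1Rate lam mu α β)) ↔ lam < β / (α + β) * mu) ∧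
    (IsErgodicChain (transProb (model2Rate lam mu α β 1)) ↔ lam < β / (α + β) * mu) ∧
    (∀ p : ℝ, 0 < p → p < 1 → lam < β / (α + β) * mu * p →
      IsStable (transProb (model2Rate lam mu α β p))) := by
  refine ⟨⟨fun h => ?_, fun h => ?_⟩, ⟨fun h => ?_, fun h => ?_⟩, fun p hp hp1 h => ?_⟩
  · obtain ⟨π, hπ⟩ := h.exists_isInvariantMass (regularRates_model1Rate hlam)
    exact lt_of_isInvariantMass_model1Rate hlam hmu hα hβ hπ
  · obtain ⟨π, hπ⟩ := exists_isInvariantMass_model1Rate hlam hmu hα hβ h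
    exact isErgodicChain_transProb (regularRates_model1Rate hlam)
      (isIrreducibleUnif_model1Rate hlam hmu hα hβ) hπ
  · obtain ⟨π, hπ⟩ := h.exists_isInvariantMass (regularRates_model2Rate hlam)
    exact lt_of_isInvariantMass_model2Rate hlam hmu hα hβ hπ
  · obtain ⟨π, hπ⟩ := exists_isInvariantMass_model2Rate hlam hmu hα hβ one_pos le_rfl
      (by rwa [mul_one])
    exact isErgodicChain_transProb (regularRates_model2Rate hlam)
      (isIrreducibleUnif_model2Rate hlam hmu hα hβ one_pos) hπ
  · obtain ⟨π, hπ⟩ := exists_isInvariantMass_model2Rate hlam hmu hα hβ hp hp1.le h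
    exact isStable_transProb (regularRates_model2Rate hlam)
      (isIrreducibleUnif_model2Rate hlam hmu hα hβ hp) hπ
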